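/- Let $R$ be an associative ring with unit, and let $S$ be a multiplicative subset of $R$ (with $1\in S$) which consists of elements that are neither left nor right zero divisors and satisfies the right Ore condition: for all $r\in R$ and $s\in S$ there are $r'\in R$ and $s'\in S$ with $rs'=sr'$. Assume that the ring of right fractions $Q=RS^{-1}$ is right $\aleph_0$-noetherian, that is, every right ideal of $Q$ is generated by an at most countable set. For a class $\mathcal C$ of right $R$-modules, let $\mathcal C^{\perp}$ (respectively ${}^{\perp}\mathcal C$) be the class of right $R$-modules $X$ with $\operatorname{Ext}^i_R(C,X)=0$ (respectively $\operatorname{Ext}^i_R(X,C)=0$) for all $C\in\mathcal C$ and all $i\ge 1$. Let $\mathcal P_1$ be the class of right $R$-modules of projective dimension at most $1$. Then the pair $(\mathcal P_1,\mathcal P_1^{\perp})$ is a hereditary cotorsion pair of countable type; that is, $\mathcal P_1={}^{\perp}(\mathcal P_1^{\perp})$, and there is a class $\mathcal S$ of right $R$-modules, each of which has a projective resolution consisting of at most countably generated projective modules, such that $\mathcal S^{\perp}=\mathcal P_1^{\perp}$. -/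

import Mathlib

universe u

noncomputable section

open CategoryTheory CategoryTheory.Abelian

namespace CountableType

/-! ### Right Ore sets of non-zero-divisors and rings of right fractions -/

section RightFractions

variable {R : Type u} [Ring R]

/-- The right Ore condition: for all `r ∈ R` and `s ∈ S` there are `r' ∈ R` and `s' ∈ S`
with `r s' = s r'`, that is, `r S ∩ s R` is non-empty. -/
def RightOreCondition (S : Submonoid R) : Prop :=
  ∀ (r : R) (s : S), ∃ (r' : R) (s' : S), r * (s' : R) = (s : R) * r'

/-- A submonoid `S` of non-zero-divisors with the right Ore condition is an Ore set, in the
(left-handed) sense of Mathlib, of the opposite ring. -/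
abbrev oreSetOp (S : Submonoid R) (hS : S ≤ nonZeroDivisors R) (hO : RightOreCondition S) :
    OreLocalization.OreSet S.op where
  ore_right_cancel r₁ r₂ s h := by
    refine ⟨1, ?_⟩
    have h2 : (s : Rᵐᵒᵖ).unop * r₁.unop = (s : Rᵐᵒᵖ).unop * r₂.unop :=
      congrArg MulOpposite.unop h
    have h3 := (hS (Submonoid.mem_op.1 s.2)).1 (r₁.unop - r₂.unop)
      (by rw [mul_sub, h2, sub_self])
    have h4 : r₁ = r₂ := MulOpposite.unop_injective (sub_eq_zero.1 h3)
    rw [h4]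
  oreNum r s :=
    MulOpposite.op (hO r.unop ⟨(s : Rᵐᵒᵖ).unop, Submonoid.mem_op.1 s.2⟩).choose
  oreDenom r s :=
    ⟨MulOpposite.op
        ((hO r.unop ⟨(s : Rᵐᵒᵖ).unop, Submonoid.mem_op.1 s.2⟩).choose_spec.choose : R),
      Submonoid.mem_op.2
        (hO r.unop ⟨(s : Rᵐᵒᵖ).unop, Submonoid.mem_op.1 s.2⟩).choose_spec.choose.2⟩
  ore_eq r s := MulOpposite.unop_injective
    (hO r.unop ⟨(s : Rᵐᵒᵖ).unop, Submonoid.mem_op.1 s.2⟩).choose_spec.choose_spec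

/-- The ring of right fractions `R S⁻¹`. Mathlib constructs rings of left fractions `s⁻¹ r`;
hence `R S⁻¹` is the opposite of the ring of left fractions of the opposite ring. -/
def RightFractionRing (S : Submonoid R) (hS : S ≤ nonZeroDivisors R)
    (hO : RightOreCondition S) : Type u :=
  letI := oreSetOp S hS hO
  (OreLocalization S.op Rᵐᵒᵖ)ᵐᵒᵖ

instance (S : Submonoid R) (hS : S ≤ nonZeroDivisors R) (hO : RightOreCondition S) :
    Ring (RightFractionRing S hS hO) :=
  letI := oreSetOp S hS hO
  inferInstanceAs (Ring (OreLocalization S.op Rᵐᵒᵖ)ᵐᵒᵖ)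

end RightFractions

/-- A ring is right `ℵ₀`-noetherian if each of its right ideals is generated by an at most
countable set. -/
def IsRightAlephZeroNoetherian (Q : Type u) [Ring Q] : Prop :=
  ∀ I : Submodule Qᵐᵒᵖ Q, ∃ t : Set Q, t.Countable ∧ Submodule.span Qᵐᵒᵖ t = I

/-! ### Classes of right modules

Right `R`-modules are modules over `Rᵐᵒᵖ`; a class of right `R`-modules is an object property
of `ModuleCat Rᵐᵒᵖ`. -/

section Classes

variable {R : Type u} [Ring R]

/-- `C^⊥`: the modules `X` with `Ext^i(C, X) = 0` for all `C` in the class and all `i ≥ 1`. -/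
def rightPerp (C : ObjectProperty (ModuleCat.{u} Rᵐᵒᵖ)) :
    ObjectProperty (ModuleCat.{u} Rᵐᵒᵖ) :=
  fun X => ∀ M : ModuleCat.{u} Rᵐᵒᵖ, C M → ∀ i : ℕ, 1 ≤ i → Subsingleton (Ext M X i)

/-- `^⊥C`: the modules `X` with `Ext^i(X, C) = 0` for all `C` in the class and all `i ≥ 1`. -/
def leftPerp (C : ObjectProperty (ModuleCat.{u} Rᵐᵒᵖ)) :
    ObjectProperty (ModuleCat.{u} Rᵐᵒᵖ) :=
  fun X => ∀ M : ModuleCat.{u} Rᵐᵒᵖ, C M → ∀ i : ℕ, 1 ≤ i → Subsingleton (Ext X M i)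

/-- `(A, B)` is a hereditary cotorsion pair: `A = ^⊥B` and `B = A^⊥`. -/
def IsHereditaryCotorsionPair (A B : ObjectProperty (ModuleCat.{u} Rᵐᵒᵖ)) : Prop :=
  A = leftPerp B ∧ B = rightPerp A

variable (R) in
/-- The class of right modules that have a projective resolution consisting of
at most countably generated projective modules. -/
def modAlephZero : ObjectProperty (ModuleCat.{u} Rᵐᵒᵖ) :=
  fun M => ∃ P : ProjectiveResolution M, ∀ n : ℕ,
    ∃ t : Set (P.complex.X n), t.Countable ∧ Submodule.span Rᵐᵒᵖ t = ⊤

/-- A hereditary cotorsion pair `(A, B)` is of countable type if `B = S^⊥` for some class `S`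
of modules having a projective resolution by at most countably generated projectives. -/
def IsOfCountableType (A B : ObjectProperty (ModuleCat.{u} Rᵐᵒᵖ)) : Prop :=
  IsHereditaryCotorsionPair A B ∧
    ∃ S : ObjectProperty (ModuleCat.{u} Rᵐᵒᵖ), S ≤ modAlephZero R ∧ rightPerp S = B

variable (R) in
/-- `P_n`: the class of right `R`-modules of projective dimension at most `n`. -/
def projDimLE (n : ℕ) : ObjectProperty (ModuleCat.{u} Rᵐᵒᵖ) :=
  fun M => HasProjectiveDimensionLE M n

end Classes

end CountableType

end

open CategoryTheory CategoryTheory.Abelian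

noncomputable section

/-! The equality of `P_1` with the left perp of its right perp holds over every ring by dimension
shifting, since first cosyzygies lie in `P_1^⊥`. The content is countable type, witnessed by the
members of `P_1` that have a countably generated projective resolution.

Write `T` for the opposite ring. A module `C` of projective dimension at most 1 is the cokernel of
an injection `K → F` with `K` projective and `F` free, and `Ext¹(C, W) = 0` says that maps `K → W`
extend to `F`. A swindle (`exists_prod_finsupp_equiv`) makes `K` free. An injection `T^(Y) → T^(X)`
is then exhausted by subsets `A` of `X` for which the preimage of `T^(A)` is spanned by basis
vectors. Such an `A` can absorb any element of `X` at the cost of countably many basis vectors on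
both sides (`IsBasisSaturated.exists_countable_extension`). The induced map on the new basis vectors
is an injection between free modules of countable rank, so maps extend over this step, and Zorn's
lemma finishes (`extendsAlong_of_countable`).

The hypothesis on `Q` makes submodules of free modules of countable rank countably generated up to
multiplication by `S`. Multiplication by a non-zero-divisor preserves supports, so this weak
generation still bounds the number of basis vectors. -/

namespace CountableType

/-! ### Countable generation up to denominators -/

section OreCountable

/-- Every submodule of `M` is, up to multiplication by elements of `S`, countably generated. -/
def HasOreCountableSubmodules {T : Type*} [Ring T] (S : Submonoid T) (M : Type*)
    [AddCommGroup M] [Module T M] : Prop :=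
  ∀ N : Submodule T M, ∃ t : Set M, t.Countable ∧ t ⊆ N ∧
    ∀ n ∈ N, ∃ s ∈ S, s • n ∈ Submodule.span T t

open OreLocalization in
/-- The left ideal of fractions `s⁻¹ a` with `a` in a given left ideal. -/
def fractionIdeal {T : Type*} [Ring T] (S : Submonoid T) [OreSet S] (I : Submodule T T) :
    Submodule (OreLocalization S T) (OreLocalization S T) where
  carrier := {q | ∃ a ∈ I, ∃ s : S, q = a /ₒ s}
  zero_mem' := ⟨0, I.zero_mem, 1, by simp⟩
  add_mem' := by
    rintro _ _ ⟨a, ha, s, rfl⟩ ⟨b, hb, s', rfl⟩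
    rw [oreDiv_add_oreDiv]
    exact ⟨_, I.add_mem (I.smul_mem _ ha) (I.smul_mem _ hb), _, rfl⟩
  smul_mem' := by
    rintro q _ ⟨a, ha, s, rfl⟩
    induction q using OreLocalization.ind with
    | _ r s' =>
      rw [oreDiv_smul_oreDiv]
      exact ⟨_, I.smul_mem _ ha, _, rfl⟩

open OreLocalization in
theorem hasOreCountableSubmodules_self {T : Type*} [Ring T] (S : Submonoid T) [OreSet S]
    (h : ∀ J : Submodule (OreLocalization S T) (OreLocalization S T),
      ∃ t : Set (OreLocalization S T), t.Countable ∧ Submodule.span (OreLocalization S T) t = J) :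
    HasOreCountableSubmodules S T := by
  intro I
  obtain ⟨t, htc, ht⟩ := h (fractionIdeal S I)
  have key : ∀ q : t, ∃ a ∈ I, ∃ s : S, (q : OreLocalization S T) = a /ₒ s := fun q => by
    have := Submodule.subset_span (R := OreLocalization S T) q.2
    rw [ht] at this
    exact this
  choose a haI s hs using key
  have := htc.to_subtype
  refine ⟨Set.range a, Set.countable_range a, Set.range_subset_iff.2 haI, fun n hn => ?_⟩
  -- The numerators of countably many generators already generate all fractions with numerator in
  -- `I`.
  have hle : fractionIdeal S I ≤ fractionIdeal S (Submodule.span T (Set.range a)) := by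
    rw [← ht, Submodule.span_le]
    exact fun q hq => ⟨_, Submodule.subset_span ⟨⟨q, hq⟩, rfl⟩, _, hs ⟨q, hq⟩⟩
  obtain ⟨x, hx, s', hxs⟩ := hle (show n /ₒ (1 : S) ∈ fractionIdeal S I from ⟨n, hn, 1, rfl⟩)
  obtain ⟨w, v, h1, h2⟩ := oreDiv_eq_iff.1 hxs
  refine ⟨v, ?_, ?_⟩
  · have h3 : (w : T) * s' = v := by simpa using h2
    exact h3 ▸ S.mul_mem w.2 s'.2
  · rw [← h1]
    exact Submodule.smul_mem _ (w : T) hx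

/-- Every submodule of a free module of countable rank inherits the countability
condition on left ideals. -/
theorem HasOreCountableSubmodules.finsupp {T : Type*} [Ring T] {S : Submonoid T}
    (h : HasOreCountableSubmodules S T) (Z : Type*) [Countable Z] :
    HasOreCountableSubmodules S (Z →₀ T) := by
  intro N
  obtain ⟨e, he⟩ := exists_injective_nat Z
  -- Filter `N` by the last nonzero coordinate in an enumeration of `Z`; the `k`-th coordinates of
  -- `F k` form a left ideal of leading coefficients.
  let F : Z → Submodule T (Z →₀ T) := fun k => N ⊓ Finsupp.supported T T {z | e z ≤ e k}
  choose t htc htI ht using fun k => h ((F k).map (Finsupp.lapply k))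
  choose! l hlF hl using fun k (a : T) (ha : a ∈ t k) => (Submodule.mem_map.1 (htI k ha))
  have hF : ∀ k, Submodule.span T (l k '' t k) ≤ F k := fun k =>
    Submodule.span_le.2 (Set.image_subset_iff.2 fun a ha => hlF k a ha)
  refine ⟨⋃ k, l k '' t k, Set.countable_iUnion fun k => (htc k).image _,
    Set.iUnion_subset fun k => (Submodule.subset_span.trans (hF k)).trans inf_le_left, ?_⟩
  have main : ∀ m : ℕ, ∀ n ∈ N, (∀ z ∈ n.support, e z < m) →
      ∃ s ∈ S, s • n ∈ Submodule.span T (⋃ k, l k '' t k) := by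
    intro m
    induction m with
    | zero =>
      intro n _ hs
      have : n = 0 := Finsupp.support_eq_empty.1
        (Finset.eq_empty_of_forall_notMem fun z hz => Nat.not_lt_zero _ (hs z hz))
      exact ⟨1, S.one_mem, by simp [this]⟩
    | succ m ih =>
      intro n hn hs
      by_cases hk : ∃ k, e k = m
      · obtain ⟨k, rfl⟩ := hk
        have hnF : n ∈ F k := ⟨hn, fun z hz => Nat.lt_succ_iff.1 (hs z hz)⟩
        obtain ⟨s, hsS, hsn⟩ := ht k _ (Submodule.mem_map_of_mem hnF)
        have hspan : Submodule.span T (t k) ≤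
            (Submodule.span T (l k '' t k)).map (Finsupp.lapply k) :=
          Submodule.span_le.2 fun a ha =>
            ⟨l k a, Submodule.subset_span ⟨a, ha, rfl⟩, hl k a ha⟩
        obtain ⟨x, hx, hxk⟩ := Submodule.mem_map.1 (hspan hsn)
        have hxF := hF k hx
        -- The leading coefficient has been cancelled, so the induction hypothesis applies to the
        -- difference.
        have hd : s • n - x ∈ F k := (F k).sub_mem ((F k).smul_mem s hnF) hxF
        obtain ⟨s', hs'S, hs'⟩ := ih (s • n - x) hd.1 fun z hz => by
          refine lt_of_le_of_ne (hd.2 hz) fun hzk => ?_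
          rw [he hzk] at hz
          refine (Finsupp.mem_support_iff.1 hz) ?_
          have : s * n k = x k := by simpa using hxk.symm
          simp [this]
        refine ⟨s' * s, S.mul_mem hs'S hsS, ?_⟩
        have hx' : x ∈ Submodule.span T (⋃ k, l k '' t k) :=
          Submodule.span_mono (Set.subset_iUnion (fun k => l k '' t k) k) hx
        have := Submodule.add_mem _ hs' (Submodule.smul_mem _ s' hx')
        rwa [← smul_add, sub_add_cancel, smul_smul] at this
      · exact ih n hn fun z hz =>
          lt_of_le_of_ne (Nat.lt_succ_iff.1 (hs z hz)) fun h => hk ⟨z, h⟩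
  intro n hn
  exact main (n.support.sup e + 1) n hn fun z hz => Nat.lt_succ_iff.2 (Finset.le_sup hz)

theorem IsRightAlephZeroNoetherian.hasOreCountableSubmodules {R : Type u} [Ring R]
    {S : Submonoid R} {hS : S ≤ nonZeroDivisors R} {hO : RightOreCondition S}
    (hQ : IsRightAlephZeroNoetherian (RightFractionRing S hS hO)) :
    HasOreCountableSubmodules S.op Rᵐᵒᵖ := by
  let := oreSetOp S hS hO
  refine hasOreCountableSubmodules_self S.op fun J => ?_
  let toOp (K : Submodule (OreLocalization S.op Rᵐᵒᵖ) (OreLocalization S.op Rᵐᵒᵖ)) :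
      Submodule (RightFractionRing S hS hO)ᵐᵒᵖ (RightFractionRing S hS hO) :=
    { carrier := {q | MulOpposite.unop (α := OreLocalization S.op Rᵐᵒᵖ) q ∈ K}
      zero_mem' := K.zero_mem
      add_mem' := fun ha hb => K.add_mem ha hb
      smul_mem' := fun c _ hq =>
        K.smul_mem (MulOpposite.unop (α := OreLocalization S.op Rᵐᵒᵖ) c.unop) hq }
  obtain ⟨t, htc, ht⟩ := hQ (toOp J)
  refine ⟨MulOpposite.unop (α := OreLocalization S.op Rᵐᵒᵖ) '' t, htc.image _, ?_⟩
  apply le_antisymm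
  · refine Submodule.span_le.2 ?_
    rintro _ ⟨q, hq, rfl⟩
    have : q ∈ toOp J := ht ▸ Submodule.subset_span hq
    exact this
  · intro x hx
    have hle : toOp J ≤ toOp (Submodule.span _
        (MulOpposite.unop (α := OreLocalization S.op Rᵐᵒᵖ) '' t)) := by
      rw [← ht, Submodule.span_le]
      exact fun q hq => Submodule.subset_span ⟨q, hq, rfl⟩
    exact hle (show MulOpposite.op x ∈ toOp J from hx)

end OreCountable

/-! ### Injections of free modules and saturated sets of basis vectors -/

section FreePresentations

variable {T : Type*} [Ring T] {X Y : Type*}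

/-- The basis vectors that a map of free modules sends into the span of a set `A` of
basis vectors. -/
def basisPreimage (i : (Y →₀ T) →ₗ[T] (X →₀ T)) (A : Set X) : Set Y :=
  {y | i (Finsupp.single y 1) ∈ Finsupp.supported T T A}

theorem basisPreimage_mono (i : (Y →₀ T) →ₗ[T] (X →₀ T)) {A A' : Set X} (h : A ⊆ A') :
    basisPreimage i A ⊆ basisPreimage i A' :=
  fun _ hy => Finsupp.supported_mono (M := T) (R := T) h hy

/-- The preimage of the span of `A` is spanned by basis vectors. -/
def IsBasisSaturated (i : (Y →₀ T) →ₗ[T] (X →₀ T)) (A : Set X) : Prop :=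
  ∀ h, i h ∈ Finsupp.supported T T A → h ∈ Finsupp.supported T T (basisPreimage i A)

/-- Project the preimage of `T^(A')` to the countable-rank module `T^(A' \ A)`, lift countable
generators of the image up to `S`, and let `B` collect the supports of the lifts. A multiple `s • h`
differs from a combination of lifts by an element that `i` sends into `T^(A)`, where saturation
applies. -/
theorem IsBasisSaturated.exists_countable_support {S : Submonoid T}
    (hS : S ≤ nonZeroDivisors T) (hT : HasOreCountableSubmodules S T)
    {i : (Y →₀ T) →ₗ[T] (X →₀ T)} {A A' : Set X} (hA : IsBasisSaturated i A)
    (hc : (A' \ A).Countable) :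
    ∃ B : Set Y, B.Countable ∧ ∀ h, i h ∈ Finsupp.supported T T A' →
      h ∈ Finsupp.supported T T (B ∪ basisPreimage i A) := by
  have := hc.to_subtype
  let p : (Y →₀ T) →ₗ[T] ((A' \ A : Set X) →₀ T) :=
    (Finsupp.lsubtypeDomain (A' \ A)).comp i
  let N := (Finsupp.supported T T A').comap i
  obtain ⟨t, htc, htN, ht⟩ := hT.finsupp (A' \ A : Set X) (N.map p)
  choose! l hlN hl using fun a (ha : a ∈ t) => Submodule.mem_map.1 (htN ha)
  let B : Set Y := ⋃ a ∈ t, ((l a).support : Set Y)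
  have hB : Submodule.span T (l '' t) ≤ Finsupp.supported T T B :=
    Submodule.span_le.2 (Set.image_subset_iff.2 fun a ha =>
      (Finsupp.mem_supported T (l a)).2 (Set.subset_biUnion_of_mem (u := fun a =>
        ((l a).support : Set Y)) ha))
  have hlt : Submodule.span T (l '' t) ≤ N :=
    Submodule.span_le.2 (Set.image_subset_iff.2 hlN)
  have htl : Submodule.span T t ≤ (Submodule.span T (l '' t)).map p :=
    Submodule.span_le.2 fun a ha => ⟨l a, Submodule.subset_span ⟨a, ha, rfl⟩, hl a ha⟩
  refine ⟨B, htc.biUnion fun a _ => (l a).support.countable_toSet, fun h hh => ?_⟩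
  obtain ⟨s, hs, hsh⟩ := ht _ (Submodule.mem_map_of_mem (p := N) (f := p) hh)
  obtain ⟨x, hx, hxp⟩ := Submodule.mem_map.1 (htl hsh)
  have hd : i (s • h - x) ∈ Finsupp.supported T T A := by
    have h1 : i (s • h - x) ∈ Finsupp.supported T T A' := N.sub_mem (N.smul_mem s hh) (hlt hx)
    intro z hz
    by_contra hzA
    have h2 : p (s • h - x) ⟨z, h1 hz, hzA⟩ = 0 := by simp [map_sub, hxp]
    exact Finsupp.mem_support_iff.1 hz h2
  have h3 : s • h ∈ Finsupp.supported T T (B ∪ basisPreimage i A) := by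
    rw [← sub_add_cancel (s • h) x]
    exact Submodule.add_mem _ (Finsupp.supported_mono Set.subset_union_right (hA _ hd))
      (Finsupp.supported_mono Set.subset_union_left (hB hx))
  -- Since `s` is a non-zero-divisor, `s • h` has the same support as `h`.
  refine fun y hy => h3 (Finsupp.mem_support_iff.2 fun h0 => Finsupp.mem_support_iff.1 hy ?_)
  exact (hS hs).1 _ h0

theorem isBasisSaturated_iUnion {ι : Type*} [Nonempty ι] {i : (Y →₀ T) →ₗ[T] (X →₀ T)}
    {A : ι → Set X} (hd : Directed (· ⊆ ·) A)
    (h : ∀ a, ∃ b, ∀ z, i z ∈ Finsupp.supported T T (A a) →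
      z ∈ Finsupp.supported T T (basisPreimage i (A b))) :
    IsBasisSaturated i (⋃ a, A a) := by
  intro z hz
  obtain ⟨a, ha⟩ := hd.exists_mem_subset_of_finset_subset_biUnion hz
  obtain ⟨b, hb⟩ := h a
  exact Finsupp.supported_mono (basisPreimage_mono i (Set.subset_iUnion A b)) (hb z ha)

/-- A closing-off argument: alternately add to `Y` the countably many vectors needed for preimages
and to `X` the supports of their images; after countably many rounds the union is saturated. -/
theorem IsBasisSaturated.exists_countable_extension {S : Submonoid T}
    (hS : S ≤ nonZeroDivisors T) (hT : HasOreCountableSubmodules S T)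
    {i : (Y →₀ T) →ₗ[T] (X →₀ T)} {A : Set X} (hA : IsBasisSaturated i A) (x : X) :
    ∃ A' : Set X, A ⊆ A' ∧ x ∈ A' ∧ IsBasisSaturated i A' ∧ (A' \ A).Countable ∧
      (basisPreimage i A' \ basisPreimage i A).Countable := by
  choose! B hBc hB using fun (A' : Set X) (hc : (A' \ A).Countable) =>
    hA.exists_countable_support hS hT hc
  let F : Set X → Set X := fun A' =>
    A' ∪ ⋃ y ∈ B A', ((i (Finsupp.single y 1)).support : Set X)
  let s : ℕ → Set X := fun n => F^[n] (A ∪ {x})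
  have hs : ∀ n, s (n + 1) = F (s n) := fun n => Function.iterate_succ_apply' F n _
  have hmono : Monotone s := monotone_nat_of_le_succ fun n => by
    rw [hs]; exact Set.subset_union_left
  have hA0 : A ⊆ s 0 := Set.subset_union_left
  have hAs : ∀ n, A ⊆ s n := fun n => hA0.trans (hmono (Nat.zero_le n))
  have hc : ∀ n, (s n \ A).Countable := by
    intro n
    induction n with
    | zero =>
      refine (Set.countable_singleton x).mono ?_
      rintro z ⟨hz | hz, hzA⟩
      exacts [absurd hz hzA, hz]
    | succ n ih =>
      rw [hs, Set.union_sdiff_distrib]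
      exact ih.union (((hBc _ ih).biUnion fun y _ => Finset.countable_toSet _).mono
        Set.sdiff_subset)
  have hc' : ((⋃ n, s n) \ A).Countable := by
    rw [Set.iUnion_sdiff]
    exact Set.countable_iUnion hc
  refine ⟨⋃ n, s n, (hAs 0).trans (Set.subset_iUnion s 0),
    Set.mem_iUnion.2 ⟨0, Or.inr rfl⟩, ?_, hc', ?_⟩
  · refine isBasisSaturated_iUnion hmono.directed_le fun n => ⟨n + 1, fun z hz => ?_⟩
    refine fun y hy => ?_
    rcases hB _ (hc n) z hz hy with h | h
    · intro w hw
      rw [hs]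
      exact Or.inr (Set.mem_biUnion h hw)
    · exact basisPreimage_mono i (hAs _) h
  · refine (hBc _ hc').mono ?_
    rintro y ⟨hy, hyA⟩
    -- This excludes the zero ring, where a basis vector has empty support.
    have h1 : (Finsupp.single y 1 : Y →₀ T) ≠ 0 := fun h0 => hyA (by
      change i _ ∈ Finsupp.supported T T A
      rw [h0, map_zero]
      exact Submodule.zero_mem _)
    have h2 : y ∈ (Finsupp.single y 1 : Y →₀ T).support := by
      rw [Finsupp.mem_support_iff, Finsupp.single_eq_same]
      exact fun h => h1 (by rw [h, Finsupp.single_zero])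
    exact (hB _ hc' _ hy h2).resolve_right hyA

/-- Every map from the source of `j` to `W` extends along `j`. -/
def ExtendsAlong {T M N : Type*} [Ring T] [AddCommGroup M] [AddCommGroup N] [Module T M]
    [Module T N] (W : Type*) [AddCommGroup W] [Module T W] (j : M →ₗ[T] N) : Prop :=
  ∀ f : M →ₗ[T] W, ∃ g : N →ₗ[T] W, g.comp j = f

variable {W : Type*} [AddCommGroup W] [Module T W]

/-- Saturation of `A` makes the induced map on the new basis vectors injective. Extending the error
`f - g ∘ i` along it gives a correction of `g` that vanishes on `T^(A)`. -/
theorem IsBasisSaturated.exists_extension_step {i : (Y →₀ T) →ₗ[T] (X →₀ T)} {A A' : Set X}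
    (hA : IsBasisSaturated i A)
    (hW : ∀ j : ((basisPreimage i A' \ basisPreimage i A : Set Y) →₀ T) →ₗ[T]
      ((A' \ A : Set X) →₀ T), Function.Injective j → ExtendsAlong W j)
    (f : (Y →₀ T) →ₗ[T] W) (g : (X →₀ T) →ₗ[T] W)
    (hg : ∀ y ∈ basisPreimage i A, g (i (Finsupp.single y 1)) = f (Finsupp.single y 1)) :
    ∃ g' : (X →₀ T) →ₗ[T] W,
      (∀ x ∈ A, g' (Finsupp.single x 1) = g (Finsupp.single x 1)) ∧
      ∀ y ∈ basisPreimage i A', g' (i (Finsupp.single y 1)) = f (Finsupp.single y 1) := by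
  classical
  let r : (X →₀ T) →ₗ[T] ((A' \ A : Set X) →₀ T) := Finsupp.lsubtypeDomain (A' \ A)
  let m : ((basisPreimage i A' \ basisPreimage i A : Set Y) →₀ T) →ₗ[T] (Y →₀ T) :=
    Finsupp.lmapDomain T T Subtype.val
  have hr : ∀ z ∈ Finsupp.supported T T A, r z = 0 := by
    intro z hz
    ext w
    by_contra hw
    exact w.2.2 (hz (Finsupp.mem_support_iff.2 hw))
  have hm : ∀ z, m z ∈ Finsupp.supported T T (basisPreimage i A' \ basisPreimage i A) := by
    intro z
    refine (Finsupp.mem_supported T _).2 fun y hy => ?_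
    obtain ⟨v, -, rfl⟩ := Finset.mem_image.1 (Finsupp.mapDomain_support hy)
    exact v.2
  have him : ∀ z ∈ Finsupp.supported T T (basisPreimage i A'),
      i z ∈ Finsupp.supported T T A' := by
    have : Finsupp.supported T T (basisPreimage i A') ≤ (Finsupp.supported T T A').comap i := by
      rw [Finsupp.supported_eq_span_single, Submodule.span_le, Set.image_subset_iff]
      exact fun y hy => hy
    exact this
  have hinj : Function.Injective ((r.comp i).comp m) := by
    refine (injective_iff_map_eq_zero _).2 fun z hz => ?_
    have h1 := him _ (Finsupp.supported_mono Set.sdiff_subset (hm z))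
    have h2 : i (m z) ∈ Finsupp.supported T T A := by
      intro w hw
      by_contra hwA
      exact Finsupp.mem_support_iff.1 hw (DFunLike.congr_fun hz ⟨w, h1 hw, hwA⟩)
    have h3 : m z = 0 := Finsupp.support_eq_empty.1 (Finset.eq_empty_of_forall_notMem
      fun y hy => (hm z hy).2 (hA _ h2 hy))
    exact Finsupp.mapDomain_injective Subtype.val_injective
      (h3.trans Finsupp.mapDomain_zero.symm)
  obtain ⟨k, hk⟩ := hW _ hinj ((f - g.comp i).comp m)
  refine ⟨g + k.comp r, fun x hx => ?_, fun y hy => ?_⟩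
  · simp [hr _ (Finsupp.single_mem_supported T 1 hx)]
  · by_cases hyA : y ∈ basisPreimage i A
    · simp [hr _ hyA, hg y hyA]
    · have := LinearMap.congr_fun hk (Finsupp.single ⟨y, hy, hyA⟩ 1)
      simp only [LinearMap.comp_apply, m, Finsupp.lmapDomain_apply, Finsupp.mapDomain_single,
        LinearMap.sub_apply] at this
      simp [this]

/-- If maps into `W` extend along every monomorphism between free modules of countable rank,
then they extend along every monomorphism between free modules. -/
theorem extendsAlong_of_countable {S : Submonoid T} (hS : S ≤ nonZeroDivisors T)
    (hT : HasOreCountableSubmodules S T) {i : (Y →₀ T) →ₗ[T] (X →₀ T)}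
    (hi : Function.Injective i)
    (hW : ∀ (V : Set Y) (Z : Set X), V.Countable → Z.Countable →
      ∀ j : (V →₀ T) →ₗ[T] (Z →₀ T), Function.Injective j → ExtendsAlong W j) :
    ExtendsAlong W i := by
  classical
  intro f
  -- Partial extensions are stored as total maps whose values outside `A` are irrelevant; `r` is
  -- therefore only a preorder.
  let D := {p : Set X × ((X →₀ T) →ₗ[T] W) // IsBasisSaturated i p.1 ∧
    ∀ y ∈ basisPreimage i p.1, p.2 (i (Finsupp.single y 1)) = f (Finsupp.single y 1)}
  let r : D → D → Prop := fun p q => p.1.1 ⊆ q.1.1 ∧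
    ∀ x ∈ p.1.1, q.1.2 (Finsupp.single x 1) = p.1.2 (Finsupp.single x 1)
  have hempty : IsBasisSaturated i ∅ := fun z hz => by
    have : z = 0 := hi (by
      rw [map_zero]
      exact (Submodule.mem_bot T).1 (by rwa [Finsupp.supported_empty] at hz))
    rw [this]
    exact Submodule.zero_mem _
  have hagree : ∀ (A : Set X) (g g' : (X →₀ T) →ₗ[T] W),
      (∀ x ∈ A, g (Finsupp.single x 1) = g' (Finsupp.single x 1)) →
      ∀ z ∈ Finsupp.supported T T A, g z = g' z := by
    intro A g g' h
    have : Finsupp.supported T T A ≤ LinearMap.eqLocus g g' := by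
      rw [Finsupp.supported_eq_span_single, Submodule.span_le, Set.image_subset_iff]
      exact h
    exact this
  have hrefl : ∀ p, r p p := fun p => ⟨subset_rfl, fun _ _ => rfl⟩
  have htrans : ∀ {p q q'}, r p q → r q q' → r p q' := fun h1 h2 =>
    ⟨h1.1.trans h2.1, fun x hx => (h2.2 x (h1.1 hx)).trans (h1.2 x hx)⟩
  obtain ⟨m, hm⟩ := exists_maximal_of_chains_bounded (r := r) (fun c hc => by
    rcases c.eq_empty_or_nonempty with rfl | hne
    · refine ⟨⟨(∅, 0), hempty, fun y hy => ?_⟩, by simp⟩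
      have : (Finsupp.single y 1 : Y →₀ T) = 0 := hi (by
        rw [map_zero]
        have hy' : i (Finsupp.single y 1) ∈ Finsupp.supported T T (∅ : Set X) := hy
        rwa [Finsupp.supported_empty, Submodule.mem_bot] at hy')
      simp [this]
    · have := hne.to_subtype
      have hdir : ∀ p q : c, ∃ q' : c, r p q' ∧ r q q' := fun p q => by
        by_cases hpq : p = q
        · exact ⟨p, hrefl _, hpq ▸ hrefl _⟩
        · rcases hc p.2 q.2 (fun h => hpq (Subtype.ext h)) with h | h
          · exact ⟨q, h, hrefl _⟩
          · exact ⟨p, hrefl _, h⟩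
      let A : c → Set X := fun p => p.1.1.1
      have hA : Directed (· ⊆ ·) A := fun p q =>
        (hdir p q).imp fun _ h => ⟨h.1.1, h.2.1⟩
      -- Glue along the chain basis vector by basis vector; the value 0 off the union is arbitrary.
      let g : (X →₀ T) →ₗ[T] W := Finsupp.linearCombination T fun x =>
        if h : ∃ p : c, x ∈ A p then h.choose.1.1.2 (Finsupp.single x 1) else 0
      have hg : ∀ (p : c), ∀ x ∈ A p, g (Finsupp.single x 1) = p.1.1.2 (Finsupp.single x 1) := by
        intro p x hx
        have h : ∃ p : c, x ∈ A p := ⟨p, hx⟩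
        obtain ⟨q, h1, h2⟩ := hdir h.choose p
        simp only [g, Finsupp.linearCombination_single, one_smul, dif_pos h]
        rw [← h1.2 x h.choose_spec, ← h2.2 x hx]
      refine ⟨⟨(⋃ p, A p, g), isBasisSaturated_iUnion hA fun p => ⟨p, p.1.2.1⟩, fun y hy => ?_⟩,
        fun p hp => ⟨Set.subset_iUnion A ⟨p, hp⟩, hg ⟨p, hp⟩⟩⟩
      obtain ⟨p, hp⟩ := hA.exists_mem_subset_of_finset_subset_biUnion hy
      exact (hagree _ _ _ (hg p) _ hp).trans (p.1.2.2 y hp)) htrans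
  have hall : ∀ x, x ∈ m.1.1 := by
    intro x
    obtain ⟨A', hAA', hx, hA', hc, hc'⟩ := m.2.1.exists_countable_extension hS hT x
    obtain ⟨g', h1, h2⟩ := m.2.1.exists_extension_step (hW _ _ hc' hc) f m.1.2 m.2.2
    exact (hm ⟨(A', g'), hA', h2⟩ ⟨hAA', h1⟩).1 hx
  refine ⟨m.1.2, Finsupp.lhom_ext' fun y => LinearMap.ext_ring ?_⟩
  exact m.2.2 y fun x _ => hall x

end FreePresentations

/-! ### From projective to free sources -/

section Swindle

variable {T : Type*} [Ring T]

/-- Finitely supported functions to a product are pairs of finitely supported functions. -/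
def finsuppProdEquiv (ι K L : Type*) [AddCommGroup K] [AddCommGroup L] [Module T K]
    [Module T L] : (ι →₀ K × L) ≃ₗ[T] (ι →₀ K) × (ι →₀ L) :=
  LinearEquiv.ofLinearMap
    ((Finsupp.mapRange.linearMap (LinearMap.fst T K L)).prod
      (Finsupp.mapRange.linearMap (LinearMap.snd T K L)))
    ((Finsupp.mapRange.linearMap (LinearMap.inl T K L)).coprod
      (Finsupp.mapRange.linearMap (LinearMap.inr T K L)))
    (by ext <;> simp) (by ext <;> simp)

/-- A projective module becomes free after adding a free module. -/
theorem exists_prod_finsupp_equiv (K : Type u) [AddCommGroup K] [Module T K]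
    [Module.Projective T K] :
    Nonempty ((K × ((ℕ × K) →₀ T)) ≃ₗ[T] ((ℕ × K) →₀ T)) := by
  obtain ⟨s, hs⟩ := Module.projective_lifting_property
    (Finsupp.linearCombination T (id : K → K)) LinearMap.id
    (Finsupp.linearCombination_id_surjective T K)
  let L := LinearMap.ker (Finsupp.linearCombination T (id : K → K))
  let e₁ : (K × L) ≃ₗ[T] (K →₀ T) :=
    LinearEquiv.ofBijective (s.coprod L.subtype) (by
      have hs' : ∀ k, Finsupp.linearCombination T (id : K → K) (s k) = k :=
        LinearMap.congr_fun hs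
      constructor
      · refine (injective_iff_map_eq_zero _).2 ?_
        rintro ⟨k, l⟩ h
        have h' : s k + (l : K →₀ T) = 0 := by simpa using h
        have hk : k = 0 := by
          have := congrArg (Finsupp.linearCombination T (id : K → K)) h'
          rwa [map_add, hs', LinearMap.mem_ker.1 l.2, add_zero, map_zero] at this
        subst hk
        have hl : l = 0 := Subtype.ext (by simpa using h')
        rw [hl]
        rfl
      · intro z
        exact ⟨(Finsupp.linearCombination T id z,
          ⟨z - s (Finsupp.linearCombination T id z), by
            rw [LinearMap.mem_ker, map_sub, hs', sub_self]⟩), by simp⟩)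
  let e₂ : ((ℕ × K) →₀ T) ≃ₗ[T] (ℕ →₀ K) × (ℕ →₀ L) :=
    (Finsupp.curryLinearEquiv T).trans
      ((Finsupp.mapRange.linearEquiv e₁.symm).trans (finsuppProdEquiv ℕ K L))
  -- Eilenberg's swindle: countably many copies of `K` absorb one more.
  let e₃ : (K × (ℕ →₀ K)) ≃ₗ[T] (ℕ →₀ K) :=
    ((Finsupp.uniqueLinearEquiv T K ()).symm.prodCongr
      (LinearEquiv.refl T (ℕ →₀ K))).trans
      ((Finsupp.sumFinsuppLEquivProdFinsupp T).symm.trans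
        (Finsupp.domLCongr ((Equiv.sumComm _ _).trans Equiv.natSumPUnitEquivNat)))
  exact ⟨((LinearEquiv.refl T K).prodCongr e₂).trans
    ((LinearEquiv.prodAssoc T K (ℕ →₀ K) (ℕ →₀ L)).symm.trans
      ((e₃.prodCongr (LinearEquiv.refl T _)).trans e₂.symm))⟩

/-- If maps into `W` extend along every monomorphism between free modules of countable rank,
then they extend along every monomorphism from a projective module to a free module. -/
theorem extendsAlong_of_projective {T : Type u} [Ring T] {S : Submonoid T}
    (hS : S ≤ nonZeroDivisors T)
    (hT : HasOreCountableSubmodules S T) {K X : Type u} [AddCommGroup K] [Module T K]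
    [Module.Projective T K] (k : K →ₗ[T] (X →₀ T)) (hk : Function.Injective k)
    {W : Type u} [AddCommGroup W] [Module T W]
    (hW : ∀ (V Z : Type u), Countable V → Countable Z →
      ∀ j : (V →₀ T) →ₗ[T] (Z →₀ T), Function.Injective j → ExtendsAlong W j) :
    ExtendsAlong W k := by
  obtain ⟨e⟩ := exists_prod_finsupp_equiv (T := T) K
  let e' := Finsupp.sumFinsuppLEquivProdFinsupp (M := T) (α := X) (β := ℕ × K) T
  -- Adding the same free module to source and target makes both free and keeps injectivity.
  let i : ((ℕ × K) →₀ T) →ₗ[T] ((X ⊕ ℕ × K) →₀ T) :=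
    e'.symm.toLinearMap ∘ₗ (k.prodMap LinearMap.id) ∘ₗ e.symm.toLinearMap
  have hi : Function.Injective i :=
    e'.symm.injective.comp ((hk.prodMap Function.injective_id).comp e.symm.injective)
  intro f
  obtain ⟨g, hg⟩ := extendsAlong_of_countable hS hT hi
    (fun V Z hV hZ => hW V Z hV.to_subtype hZ.to_subtype)
    (f ∘ₗ LinearMap.fst T K _ ∘ₗ e.symm.toLinearMap)
  refine ⟨g ∘ₗ e'.symm.toLinearMap ∘ₗ LinearMap.inl T _ _, LinearMap.ext fun x => ?_⟩
  have := LinearMap.congr_fun hg (e (x, 0))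
  simpa [i] using this

end Swindle

/-! ### `Ext¹` as an extension problem, and two-term resolutions -/

section ShortExact

variable {C : Type*} [Category C] [Abelian C]

theorem subsingleton_ext_one_of_extension [HasExt C] {S : ShortComplex C} (hS : S.ShortExact)
    [Projective S.X₂] {W : C} (h : ∀ f : S.X₁ ⟶ W, ∃ g : S.X₂ ⟶ W, S.f ≫ g = f) :
    Subsingleton (Ext S.X₃ W 1) := by
  refine subsingleton_of_forall_eq 0 fun e => ?_
  obtain ⟨x, rfl⟩ := Ext.contravariant_sequence_exact₃ hS W e
    (Ext.eq_zero_of_projective _) (add_zero 1)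
  obtain ⟨f, rfl⟩ := Ext.homEquiv₀.symm.surjective x
  obtain ⟨g, rfl⟩ := h f
  rw [Ext.homEquiv₀_symm_apply, ← Ext.mk₀_comp_mk₀]
  exact hS.extClass_comp_assoc (Ext.mk₀ g)

theorem exists_extension_of_subsingleton_ext_one [HasExt C] {S : ShortComplex C}
    (hS : S.ShortExact) {W : C} (h : Subsingleton (Ext S.X₃ W 1)) (f : S.X₁ ⟶ W) :
    ∃ g : S.X₂ ⟶ W, S.f ≫ g = f := by
  obtain ⟨x, hx⟩ := Ext.contravariant_sequence_exact₁ hS W (Ext.mk₀ f) (add_zero 1)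
    (Subsingleton.elim _ _)
  obtain ⟨g, rfl⟩ := Ext.homEquiv₀.symm.surjective x
  exact ⟨g, Ext.homEquiv₀.symm.injective (by simpa using hx)⟩

open Limits ZeroObject

/-- The terms of the complex `⋯ ⟶ 0 ⟶ X₁ ⟶ X₂` attached to a short complex. -/
def twoTermX (S : ShortComplex C) : ℕ → C
  | 0 => S.X₂
  | 1 => S.X₁
  | _ + 2 => 0

/-- The differentials of the complex `⋯ ⟶ 0 ⟶ X₁ ⟶ X₂` attached to a short complex. -/
def twoTermD (S : ShortComplex C) : ∀ n, twoTermX S (n + 1) ⟶ twoTermX S n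
  | 0 => S.f
  | _ + 1 => 0

/-- The complex `⋯ ⟶ 0 ⟶ X₁ ⟶ X₂` attached to a short complex. -/
def twoTermComplex (S : ShortComplex C) : ChainComplex C ℕ :=
  ChainComplex.of (twoTermX S) (twoTermD S) fun _ => (isZero_zero C).eq_of_src _ _

theorem twoTermComplex_d_one_zero (S : ShortComplex C) : (twoTermComplex S).d 1 0 = S.f :=
  ChainComplex.of_d (twoTermX S) (twoTermD S) 0

theorem twoTermComplex_exactAt_succ {S : ShortComplex C} (hS : S.ShortExact) (n : ℕ) :
    (twoTermComplex S).ExactAt (n + 1) := by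
  rw [HomologicalComplex.exactAt_iff' _ (n + 1 + 1) (n + 1) n (by simp) (by simp)]
  cases n with
  | zero =>
    refine (ShortComplex.exact_iff_mono _ ((isZero_zero C).eq_of_src _ _)).2 ?_
    change Mono ((twoTermComplex S).d 1 0)
    rw [twoTermComplex_d_one_zero]
    exact hS.mono_f
  | succ n => exact ShortComplex.exact_of_isZero_X₂ _ (isZero_zero C)

/-- A short exact sequence `0 ⟶ X₁ ⟶ X₂ ⟶ X₃ ⟶ 0` with `X₁` and `X₂` projective is a
projective resolution of `X₃`. -/
def twoTermResolution {S : ShortComplex C} (hS : S.ShortExact) [Projective S.X₁]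
    [Projective S.X₂] : ProjectiveResolution S.X₃ where
  complex := twoTermComplex S
  projective
    | 0 => inferInstanceAs (Projective S.X₂)
    | 1 => inferInstanceAs (Projective S.X₁)
    | _ + 2 => inferInstanceAs (Projective (0 : C))
  π := (ChainComplex.toSingle₀Equiv _ _).symm ⟨S.g, by
    rw [twoTermComplex_d_one_zero]; exact S.zero⟩
  quasiIso := ⟨fun n => by
    cases n
    · rw [ChainComplex.quasiIsoAt₀_iff, ShortComplex.quasiIso_iff_of_zeros']
      · refine (ShortComplex.exact_and_epi_g_iff_of_iso ?_).2 ⟨hS.exact, hS.epi_g⟩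
        exact ShortComplex.isoMk (Iso.refl _) (Iso.refl _) (Iso.refl _)
          ((Category.id_comp _).trans ((twoTermComplex_d_one_zero S).symm.trans
            (Category.comp_id _).symm))
          (by
            refine (Category.id_comp _).trans (Eq.trans ?_ (Category.comp_id _).symm)
            exact (ChainComplex.toSingle₀Equiv_symm_apply_f_zero (C := twoTermComplex S) S.g _).symm)
      all_goals rfl
    · rw [quasiIsoAt_iff_exactAt']
      · exact twoTermComplex_exactAt_succ hS _
      · apply ChainComplex.exactAt_succ_single_obj⟩

end ShortExact

/-! ### The cotorsion pair and its countable type -/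

section CotorsionPair

variable {R : Type u} [Ring R]

theorem projDimLE_one_eq_leftPerp :
    projDimLE R 1 = leftPerp (rightPerp (projDimLE R 1)) := by
  ext X
  constructor
  · intro hX M hM i hi
    exact hM X hX i hi
  · intro hX
    refine hasProjectiveDimensionLT_of_enoughInjectives X 2 fun Y => ?_
    obtain ⟨p⟩ := EnoughInjectives.presentation Y
    have h : (ShortComplex.mk _ _ (Limits.cokernel.condition p.f)).ShortExact :=
      { exact := ShortComplex.exact_cokernel p.f }
    -- For `I` the injective hull-like target of `p.f`, `Ext^i(C, I/Y)` embeds in `Ext^(i+1)(C, Y)`,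
    -- which is zero for `C` in `P_1`. The same sequence then makes `Ext²(X, Y)` a quotient of
    -- `Ext¹(X, I/Y) = 0`.
    have hperp : rightPerp (projDimLE R 1) (Limits.cokernel p.f) := by
      intro C hC i hi
      have : HasProjectiveDimensionLT C 2 := hC
      refine subsingleton_of_forall_eq 0 fun e => ?_
      obtain ⟨x, rfl⟩ := Ext.covariant_sequence_exact₃ C h e rfl
        (Ext.eq_zero_of_hasProjectiveDimensionLT _ 2 (by lia))
      obtain ⟨j, rfl⟩ := Nat.exists_eq_add_of_le' hi
      rw [Ext.eq_zero_of_injective x, Ext.zero_comp]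
    have := hX _ hperp 1 le_rfl
    refine subsingleton_of_forall_eq 0 fun e => ?_
    obtain ⟨x, rfl⟩ := Ext.covariant_sequence_exact₁ X h e (Ext.eq_zero_of_injective _)
      (show 1 + 1 = 2 from rfl)
    rw [Subsingleton.elim x 0, Ext.zero_comp]

theorem shortExact_mkQ_range {T : Type u} [Ring T] {M N : Type u} [AddCommGroup M]
    [AddCommGroup N] [Module T M] [Module T N] {j : M →ₗ[T] N} (hj : Function.Injective j) :
    (ModuleCat.shortComplexOfCompEqZero j (LinearMap.range j).mkQ
      (LinearMap.range_mkQ_comp j)).ShortExact :=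
  ModuleCat.shortComplex_shortExact _ (LinearMap.exact_map_mkQ_range j) hj
    (Submodule.mkQ_surjective _)

theorem modAlephZero_of_shortExact {S : ShortComplex (ModuleCat.{u} Rᵐᵒᵖ)} (hS : S.ShortExact)
    [Projective S.X₁] [Projective S.X₂]
    (h₁ : ∃ t : Set S.X₁, t.Countable ∧ Submodule.span Rᵐᵒᵖ t = ⊤)
    (h₂ : ∃ t : Set S.X₂, t.Countable ∧ Submodule.span Rᵐᵒᵖ t = ⊤) :
    modAlephZero R S.X₃ := by
  refine ⟨twoTermResolution hS, fun n => ?_⟩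
  match n with
  | 0 => exact h₂
  | 1 => exact h₁
  | n + 2 =>
    have : Subsingleton ((twoTermResolution hS).complex.X (n + 2)) :=
      ModuleCat.subsingleton_of_isZero (Limits.isZero_zero _)
    exact ⟨∅, Set.countable_empty, Subsingleton.elim _ _⟩

theorem exists_countable_span_finsupp_eq_top {T : Type*} [Ring T] (V : Type*) [Countable V] :
    ∃ t : Set (V →₀ T), t.Countable ∧ Submodule.span T t = ⊤ :=
  ⟨Set.range fun v => Finsupp.single v 1, Set.countable_range _,
    (Finsupp.basisSingleOne (R := T) (ι := V)).span_eq ▸ by simp⟩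

theorem projective_ker_of_hasProjectiveDimensionLT_two {T : Type u} [Ring T] {M : ModuleCat.{u} T}
    [HasProjectiveDimensionLT M 2] {P : Type u} [AddCommGroup P] [Module T P]
    [Module.Projective T P] {p : P →ₗ[T] M} (hp : Function.Surjective p) :
    Module.Projective T (LinearMap.ker p) := by
  have hE := LinearMap.shortExact_shortComplexKer hp
  have hP : Projective (ModuleCat.of T P) := inferInstance
  have hM : HasProjectiveDimensionLT (LinearMap.shortComplexKer p).X₃ 2 :=
    inferInstanceAs (HasProjectiveDimensionLT M 2)
  have hK := projective_iff_hasProjectiveDimensionLT_one.2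
    ((hE.hasProjectiveDimensionLT_X₃_iff 0 hP).1 hM)
  exact (IsProjective.iff_projective (LinearMap.ker p)).2 hK

/-- If `Ext¹(-, W)` vanishes on the modules with a resolution of length one by countably
generated projective modules, then it vanishes on all modules of projective dimension at
most one. -/
theorem subsingleton_ext_one_of_countable {T : Type u} [Ring T] {S : Submonoid T}
    (hS : S ≤ nonZeroDivisors T) (hT : HasOreCountableSubmodules S T) {W : ModuleCat.{u} T}
    (h : ∀ E : ShortComplex (ModuleCat.{u} T), E.ShortExact → Projective E.X₁ → Projective E.X₂ →
      (∃ t : Set E.X₁, t.Countable ∧ Submodule.span T t = ⊤) →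
      (∃ t : Set E.X₂, t.Countable ∧ Submodule.span T t = ⊤) → Subsingleton (Ext E.X₃ W 1))
    (C : ModuleCat.{u} T) [HasProjectiveDimensionLT C 2] : Subsingleton (Ext C W 1) := by
  have hp := Finsupp.linearCombination_id_surjective T C
  have := projective_ker_of_hasProjectiveDimensionLT_two hp
  have hext := extendsAlong_of_projective hS hT (W := W)
    (K := LinearMap.ker (Finsupp.linearCombination T (id : C → C))) (X := C)
    (Submodule.subtype _) (Submodule.injective_subtype _) fun V Z _ _ j hj f => by
      have hE := shortExact_mkQ_range hj
      obtain ⟨g, hg⟩ := exists_extension_of_subsingleton_ext_one hE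
        (h _ hE inferInstance inferInstance (exists_countable_span_finsupp_eq_top V)
          (exists_countable_span_finsupp_eq_top Z)) (ModuleCat.ofHom f)
      exact ⟨g.hom, congrArg ModuleCat.Hom.hom hg⟩
  refine subsingleton_ext_one_of_extension (LinearMap.shortExact_shortComplexKer hp) fun f => ?_
  obtain ⟨g, hg⟩ := hext f.hom
  exact ⟨ModuleCat.ofHom g, ModuleCat.hom_ext hg⟩

/-- Degrees at least 2 vanish by projective dimension, so only `Ext¹` needs the reduction to
countable presentations. Passing to the opposite ring swaps the two sides of the non-zero-divisor
condition. -/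
theorem rightPerp_projDimLE_one_inf_modAlephZero {S : Submonoid R}
    (hS : S ≤ nonZeroDivisors R) (hR : HasOreCountableSubmodules S.op Rᵐᵒᵖ) :
    rightPerp (projDimLE R 1 ⊓ modAlephZero R) = rightPerp (projDimLE R 1) := by
  have hSop : S.op ≤ nonZeroDivisors Rᵐᵒᵖ := fun s hs =>
    ⟨fun a ha => MulOpposite.unop_injective
        ((hS (Submonoid.mem_op.1 hs)).2 a.unop (congrArg MulOpposite.unop ha)),
      fun a ha => MulOpposite.unop_injective
        ((hS (Submonoid.mem_op.1 hs)).1 a.unop (congrArg MulOpposite.unop ha))⟩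
  ext W
  constructor
  · intro hW C hC i hi
    have hC' : HasProjectiveDimensionLT C 2 := hC
    rcases hi.eq_or_lt with rfl | hi
    · exact subsingleton_ext_one_of_countable hSop hR (fun E hE _ hP h₁ h₂ =>
        hW _ ⟨(hE.hasProjectiveDimensionLT_X₃_iff 0 hP).2 inferInstance,
          modAlephZero_of_shortExact hE h₁ h₂⟩ 1 le_rfl) C
    · exact HasProjectiveDimensionLT.subsingleton C 2 i hi W
  · intro hW C hC
    exact hW C hC.1

end CotorsionPair

end CountableType

end

theorem mainTheorem11 {R : Type u} [Ring R] (S : Submonoid R) (hS : S ≤ nonZeroDivisors R)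
    (hO : CountableType.RightOreCondition S)
    (hQ : CountableType.IsRightAlephZeroNoetherian (CountableType.RightFractionRing S hS hO)) :
    CountableType.IsOfCountableType (CountableType.projDimLE R 1)
      (CountableType.rightPerp (CountableType.projDimLE R 1)) :=
  ⟨⟨CountableType.projDimLE_one_eq_leftPerp, rfl⟩, _, inf_le_right,
    CountableType.rightPerp_projDimLE_one_inf_modAlephZero hS hQ.hasOreCountableSubmodules⟩
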